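/- Let $H$ be a complex Hilbert space and let $L_0$ be a closed, densely defined, symmetric operator in $H$ which is positive definite, i.e. $(L_0y,y)\ge\varkappa\|y\|^2$ for all $y\in\operatorname{Dom}L_0$ with some constant $\varkappa>0$. Assume that $L_0$ has nonzero defect indices, i.e. $\mathcal K:=\operatorname{Ker}L_0^*\neq\{0\}$. Let $L$ be the Friedrichs extension of $L_0$, and put $\Gamma_1:=L^{-1}L_0^*-I$ on $\operatorname{Dom}L_0^*$. Consider the dynamical system with boundary control $\alpha_{L_0}$: $$u_{tt}+L_0^*u=0\ \ (t>0),\qquad u|_{t=0}=u_t|_{t=0}=0,\qquad \Gamma_1u=h\ \ (t\ge 0).$$ For a control $h\in C^2([0,\infty);\mathcal K)$ with $h(0)=h'(0)=0$, the (weak) solution of $\alpha_{L_0}$ is, by definition, $$u^h(t):=-h(t)+\int_0^tL^{-1/2}\sin\big[(t-s)L^{1/2}\big]\,h''(s)\,ds,\qquad t\ge0.$$ Let $\mathcal U^t:=\{u^h(t)\}$, with $h$ running over all such controls, be the set of states reachable at the moment $t$, and let $\mathcal U$ be the total reachable set, i.e. the algebraic sum (linear span) of all $\mathcal U^t$, $t\ge0$.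 The system $\alpha_{L_0}$ is called controllable if $\mathcal U$ is dense in $H$. A symmetric operator $A$ is said to have a self-adjoint part in a closed subspace $\mathcal N\subset H$ if $\mathcal N\cap\operatorname{Dom}A$ is dense in $\mathcal N$, $A[\mathcal N\cap\operatorname{Dom}A]\subset\mathcal N$, and $A|_{\mathcal N\cap\operatorname{Dom}A}$ is a self-adjoint operator in the Hilbert space $\mathcal N$; it is called completely non-self-adjoint if it has a self-adjoint part in no nonzero closed subspace of $H$. Then the system $\alpha_{L_0}$ is controllable if and only if $L_0$ is completely non-self-adjoint. -/

import Mathlib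

noncomputable section

open Filter Topology Set
open scoped InnerProductSpace

variable {H : Type*} [NormedAddCommGroup H] [InnerProductSpace ℂ H]

/-- `A` is a closed, densely defined, symmetric, positive definite operator in `H`:
`(A y, y) ≥ κ ‖y‖²` on `Dom A` for some constant `κ > 0`. -/
structure IsPosDefSymmetric (A : H →ₗ.[ℂ] H) : Prop where
  isClosed : A.IsClosed
  dense : Dense (A.domain : Set H)
  symm : A.IsFormalAdjoint A
  pos : ∃ κ : ℝ, 0 < κ ∧ ∀ y : A.domain, κ * ‖(y : H)‖ ^ 2 ≤ (⟪A y, (y : H)⟫_ℂ).re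

/-! ### The Friedrichs extension -/

/-- `Dom A`, to be equipped with the energy inner product `(A x, y)`. -/
def EnergySpace (A : H →ₗ.[ℂ] H) (_ : IsPosDefSymmetric A) : Type _ := A.domain

namespace EnergySpace

variable {A : H →ₗ.[ℂ] H} {hA : IsPosDefSymmetric A}

instance : AddCommGroup (EnergySpace A hA) := inferInstanceAs (AddCommGroup A.domain)

instance : Module ℂ (EnergySpace A hA) := inferInstanceAs (Module ℂ A.domain)

/-- The identity map, from `Dom A` with the energy inner product to `Dom A`. -/
def toDom (A : H →ₗ.[ℂ] H) (hA : IsPosDefSymmetric A) : EnergySpace A hA ≃ₗ[ℂ] A.domain :=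
  LinearEquiv.refl ℂ A.domain

/-- The energy inner product `(A x, y)` on `Dom A`. -/
@[reducible] def core (A : H →ₗ.[ℂ] H) (hA : IsPosDefSymmetric A) :
    InnerProductSpace.Core ℂ (EnergySpace A hA) where
  inner x y := ⟪A (toDom A hA x), (toDom A hA y : H)⟫_ℂ
  conj_inner_symm x y := by
    rw [inner_conj_symm]
    exact (hA.symm (toDom A hA x) (toDom A hA y)).symm
  re_inner_nonneg x := by
    obtain ⟨κ, hκ, h⟩ := hA.pos
    exact (by positivity : (0 : ℝ) ≤ κ * ‖(toDom A hA x : H)‖ ^ 2).trans (h (toDom A hA x))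
  add_left x y z := by
    change ⟪A ((toDom A hA x) + (toDom A hA y)), _⟫_ℂ = _
    rw [LinearPMap.map_add, inner_add_left]
  smul_left x y r := by
    change ⟪A (r • (toDom A hA x)), _⟫_ℂ = _
    rw [LinearPMap.map_smul, inner_smul_left]
  definite x hx := by
    obtain ⟨κ, hκ, h⟩ := hA.pos
    have h1 := h (toDom A hA x)
    have h2 : (⟪A (toDom A hA x), (toDom A hA x : H)⟫_ℂ).re = 0 := by
      have := congrArg Complex.re hx
      simpa using this
    have h3 : ‖(toDom A hA x : H)‖ ^ 2 = 0 := by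
      have h4 : κ * ‖(toDom A hA x : H)‖ ^ 2 ≤ 0 := h1.trans h2.le
      have h5 : 0 ≤ ‖(toDom A hA x : H)‖ ^ 2 := by positivity
      nlinarith
    have h6 : (toDom A hA x : H) = 0 := by simpa using h3
    exact (toDom A hA).injective (Subtype.ext h6)

instance : NormedAddCommGroup (EnergySpace A hA) := (core A hA).toNormedAddCommGroup

instance : InnerProductSpace ℂ (EnergySpace A hA) := .ofCore (core A hA).toCore

/-- The embedding of `Dom A`, with the energy norm, into `H`. -/
def inclₗ (A : H →ₗ.[ℂ] H) (hA : IsPosDefSymmetric A) : EnergySpace A hA →ₗ[ℂ] H :=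
  A.domain.subtype ∘ₗ (toDom A hA).toLinearMap

theorem exists_bound (A : H →ₗ.[ℂ] H) (hA : IsPosDefSymmetric A) :
    ∃ C : ℝ, ∀ x : EnergySpace A hA, ‖inclₗ A hA x‖ ≤ C * ‖x‖ := by
  obtain ⟨κ, hκ, h⟩ := hA.pos
  refine ⟨√κ⁻¹, fun x => ?_⟩
  have h1 : κ * ‖inclₗ A hA x‖ ^ 2 ≤ ‖x‖ ^ 2 := by
    rw [← inner_self_eq_norm_sq (𝕜 := ℂ) x]
    exact h (toDom A hA x)
  have h2 : ‖inclₗ A hA x‖ ^ 2 ≤ (√κ⁻¹ * ‖x‖) ^ 2 := by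
    rw [mul_pow, Real.sq_sqrt (by positivity), inv_mul_eq_div, le_div_iff₀ hκ]
    linarith
  exact le_of_sq_le_sq h2 (by positivity)

end EnergySpace

/-- The form domain of `A`: the limits in `H` of the sequences in `Dom A` that are Cauchy
in the energy norm. -/
def formDomain (A : H →ₗ.[ℂ] H) (hA : IsPosDefSymmetric A) : Submodule ℂ H where
  carrier := {x | ∃ u : ℕ → EnergySpace A hA, CauchySeq u ∧
    Tendsto (fun n => EnergySpace.inclₗ A hA (u n)) atTop (𝓝 x)}
  zero_mem' := ⟨fun _ => 0, cauchySeq_const 0, by simp⟩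
  add_mem' := by
    rintro x y ⟨u, hu, hux⟩ ⟨v, hv, hvy⟩
    exact ⟨fun n => u n + v n, hu.add hv, by simpa using hux.add hvy⟩
  smul_mem' := by
    rintro c x ⟨u, hu, hux⟩
    exact ⟨fun n => c • u n, (uniformContinuous_const_smul c).comp_cauchySeq hu, by simpa using hux.const_smul c⟩

variable [CompleteSpace H]

/-- The Friedrichs extension of `A`: the restriction of `A^*` to `Dom A^* ∩ formDomain A`. -/
def friedrichs (A : H →ₗ.[ℂ] H) (hA : IsPosDefSymmetric A) : H →ₗ.[ℂ] H :=
  A.adjoint.domRestrict (formDomain A hA)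

theorem exists_energyCompletion_map (A : H →ₗ.[ℂ] H) (hA : IsPosDefSymmetric A) :
    ∃ j : UniformSpace.Completion (EnergySpace A hA) →L[ℂ] H,
      (∀ x : EnergySpace A hA, j x = EnergySpace.inclₗ A hA x) ∧
      (∀ (w : UniformSpace.Completion (EnergySpace A hA)) (y : EnergySpace A hA),
        ⟪j w, A (EnergySpace.toDom A hA y)⟫_ℂ = ⟪w, (y : UniformSpace.Completion (EnergySpace A hA))⟫_ℂ) := by
  obtain ⟨C, hC⟩ := EnergySpace.exists_bound A hA
  let i : EnergySpace A hA →L[ℂ] H := (EnergySpace.inclₗ A hA).mkContinuous C hC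
  let c : EnergySpace A hA →L[ℂ] UniformSpace.Completion (EnergySpace A hA) :=
    UniformSpace.Completion.toComplL
  let j : UniformSpace.Completion (EnergySpace A hA) →L[ℂ] H := i.extend c
  have hj : ∀ x : EnergySpace A hA, j x = EnergySpace.inclₗ A hA x := fun x =>
    i.extend_eq (e := c) UniformSpace.Completion.denseRange_coe
      (UniformSpace.Completion.isUniformInducing_coe _) x
  refine ⟨j, hj, fun w y => ?_⟩
  induction w using UniformSpace.Completion.induction_on with
  | hp => exact isClosed_eq (by fun_prop) (by fun_prop)
  | ih x =>
    rw [hj, UniformSpace.Completion.inner_coe]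
    exact (hA.symm (EnergySpace.toDom A hA x) (EnergySpace.toDom A hA y)).symm

theorem exists_friedrichs_inverse (A : H →ₗ.[ℂ] H) (hA : IsPosDefSymmetric A) :
    ∃ B : H →L[ℂ] H,
      (∀ f : H, ∃ hf : B f ∈ (friedrichs A hA).domain, friedrichs A hA ⟨B f, hf⟩ = f) ∧
      ∀ x : (friedrichs A hA).domain, B (friedrichs A hA x) = x := by
  obtain ⟨j, hj, hjA⟩ := exists_energyCompletion_map A hA
  have key : ∀ f : H, ∃ hf : j (j.adjoint f) ∈ (friedrichs A hA).domain,
      friedrichs A hA ⟨j (j.adjoint f), hf⟩ = f := by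
    intro f
    have h1 : ∀ y : A.domain, ⟪f, (y : H)⟫_ℂ = ⟪j (j.adjoint f), A y⟫_ℂ := by
      intro y
      have h0 := hjA (j.adjoint f) ((EnergySpace.toDom A hA).symm y)
      rw [LinearEquiv.apply_symm_apply] at h0
      rw [h0, ContinuousLinearMap.adjoint_inner_left, hj]
      rfl
    have h2 : j (j.adjoint f) ∈ A.adjoint.domain :=
      LinearPMap.mem_adjoint_domain_of_exists _ ⟨f, h1⟩
    have h3 : j (j.adjoint f) ∈ formDomain A hA := by
      obtain ⟨s, hs, hlim⟩ := mem_closure_iff_seq_limit.1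
        (UniformSpace.Completion.denseRange_coe (j.adjoint f))
      choose u hu using hs
      have hlim' : Tendsto (fun n => ((u n : EnergySpace A hA) :
          UniformSpace.Completion (EnergySpace A hA))) atTop (𝓝 (j.adjoint f)) := by
        simpa only [hu] using hlim
      refine ⟨u, ?_, ?_⟩
      · exact (UniformSpace.Completion.isUniformInducing_coe _).cauchy_map_iff.1 hlim'.cauchySeq
      · simpa only [Function.comp_def, hj] using (j.continuous.tendsto _).comp hlim'
    refine ⟨⟨h3, h2⟩, ?_⟩
    have h4 : friedrichs A hA ⟨j (j.adjoint f), ⟨h3, h2⟩⟩ = A.adjoint ⟨j (j.adjoint f), h2⟩ :=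
      LinearPMap.domRestrict_apply rfl
    rw [h4]
    exact LinearPMap.adjoint_apply_eq hA.dense _ h1
  have inj : ∀ x : (friedrichs A hA).domain, friedrichs A hA x = 0 → (x : H) = 0 := by
    rintro ⟨x, ⟨u, hu, hux⟩, hx⟩ h0
    have h4 : friedrichs A hA ⟨x, ⟨⟨u, hu, hux⟩, hx⟩⟩ = A.adjoint ⟨x, hx⟩ :=
      LinearPMap.domRestrict_apply rfl
    have hu' : CauchySeq (fun n => ((u n : EnergySpace A hA) :
        UniformSpace.Completion (EnergySpace A hA))) :=
      (UniformSpace.Completion.isUniformInducing_coe _).cauchy_map_iff.2 hu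
    obtain ⟨w, hw⟩ := cauchySeq_tendsto_of_complete hu'
    have hjw : j w = x := by
      refine tendsto_nhds_unique ?_ hux
      simpa only [Function.comp_def, hj] using (j.continuous.tendsto w).comp hw
    have hw0 : w = 0 := by
      refine UniformSpace.Completion.denseRange_coe.eq_zero_of_inner_left ℂ ?_
      intro y
      have := hjA w y
      rw [← LinearPMap.adjoint_isFormalAdjoint hA.dense ⟨j w, hjw ▸ hx⟩ (EnergySpace.toDom A hA y)] at this
      rw [← this]
      have h5 : A.adjoint ⟨j w, hjw ▸ hx⟩ = 0 := by
        rw [← h0, h4]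
        congr 1
        exact Subtype.ext hjw
      rw [h5, inner_zero_left]
    change x = 0
    rw [← hjw, hw0, map_zero]
  refine ⟨j ∘L j.adjoint, key, fun x => ?_⟩
  obtain ⟨hf, h⟩ := key (friedrichs A hA x)
  have := inj (⟨_, hf⟩ - x) (by rw [LinearPMap.map_sub, h, sub_self])
  exact sub_eq_zero.1 this

/-- The bounded inverse `L⁻¹` of the Friedrichs extension `L` of `A`. -/
def friedrichsInv (A : H →ₗ.[ℂ] H) (hA : IsPosDefSymmetric A) : H →L[ℂ] H :=
  (exists_friedrichs_inverse A hA).choose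

/-! ### The dynamical system with boundary control -/

/-- The operator `L^{-1/2} sin (t L^{1/2})`, where `L` is the Friedrichs extension of `A`:
the function `λ ↦ λ^{-1/2} sin (t λ^{1/2})` of `L` is written as a continuous function
of `μ = λ⁻¹` and applied to the bounded operator `L⁻¹`. -/
def sineOp (A : H →ₗ.[ℂ] H) (hA : IsPosDefSymmetric A) (t : ℝ) : H →L[ℂ] H :=
  cfc (fun μ : ℝ => √μ * Real.sin (t * (√μ)⁻¹)) (friedrichsInv A hA)

/-- `Ker A^*`, as a subspace of `H`. -/
def adjointKer (A : H →ₗ.[ℂ] H) : Submodule ℂ H :=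
  (LinearMap.ker A.adjoint.toFun).map A.adjoint.domain.subtype

/-- The admissible boundary controls: `h ∈ C²([0, ∞); Ker A^*)` with `h(0) = h'(0) = 0`. -/
def IsControl (A : H →ₗ.[ℂ] H) (h : ℝ → adjointKer A) : Prop :=
  ContDiffOn ℝ 2 h (Ici 0) ∧ h 0 = 0 ∧ derivWithin h (Ici 0) 0 = 0

/-- The weak solution
`u^h(t) = -h(t) + ∫_0^t L^{-1/2} sin ((t - s) L^{1/2}) h''(s) ds` of
`u_tt + A^* u = 0`, `u(0) = u_t(0) = 0`, `Γ₁ u = h`, where `Γ₁ = L⁻¹ A^* - I`. -/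
def weakSolution (A : H →ₗ.[ℂ] H) (hA : IsPosDefSymmetric A) (h : ℝ → adjointKer A)
    (t : ℝ) : H :=
  -(h t : H) + ∫ s in (0 : ℝ)..t,
    sineOp A hA (t - s) ((iteratedDerivWithin 2 h (Ici 0) s : adjointKer A) : H)

/-- The set `U^t` of the states reachable at the moment `t`. -/
def reachableSet (A : H →ₗ.[ℂ] H) (hA : IsPosDefSymmetric A) (t : ℝ) : Set H :=
  {x | ∃ h : ℝ → adjointKer A, IsControl A h ∧ weakSolution A hA h t = x}

/-- The total reachable set: the algebraic sum of all `U^t`, `t ≥ 0`. -/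
def totalReachableSet (A : H →ₗ.[ℂ] H) (hA : IsPosDefSymmetric A) : Submodule ℂ H :=
  Submodule.span ℂ (⋃ t ∈ Ici (0 : ℝ), reachableSet A hA t)

/-- The system is controllable: the total reachable set is dense in `H`. -/
def IsControllable (A : H →ₗ.[ℂ] H) (hA : IsPosDefSymmetric A) : Prop :=
  Dense (totalReachableSet A hA : Set H)

/-! ### Completely non-self-adjoint operators -/

/-- The restriction of `A` to `N ∩ Dom A`, as an operator in `N`, when `A [N ∩ Dom A] ⊆ N`. -/
def partIn (A : H →ₗ.[ℂ] H) (N : Submodule ℂ H)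
    (hN : ∀ x : A.domain, (x : H) ∈ N → A x ∈ N) : N →ₗ.[ℂ] N where
  domain := A.domain.comap N.subtype
  toFun :=
    { toFun := fun x => ⟨A ⟨(x : N), x.2⟩, hN ⟨(x : N), x.2⟩ (x : N).2⟩
      map_add' := fun x y => Subtype.ext (A.map_add ⟨(x : N), x.2⟩ ⟨(y : N), y.2⟩)
      map_smul' := fun c x => Subtype.ext (A.map_smul c ⟨(x : N), x.2⟩) }

/-- `A` has a self-adjoint part in the closed (equivalently, complete) subspace `N`. -/
def HasSelfAdjointPart (A : H →ₗ.[ℂ] H) (N : Submodule ℂ H) [CompleteSpace N] : Prop :=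
  Dense {x : N | (x : H) ∈ A.domain} ∧
    ∃ hN : ∀ x : A.domain, (x : H) ∈ N → A x ∈ N, IsSelfAdjoint (partIn A N hN)

/-- `A` has a self-adjoint part in no nonzero closed subspace. -/
def IsCompletelyNonSelfAdjoint (A : H →ₗ.[ℂ] H) : Prop :=
  ∀ (N : Submodule ℂ H) [CompleteSpace N], N ≠ ⊥ → ¬ HasSelfAdjointPart A N

end

/-!
Write `A` for `L₀`, let `L` be its Friedrichs extension, and let `B = L⁻¹` and `K = Ker A^*`. Both properties in the
theorem say that one closed subspace is zero, namely the largest `B`-invariant subspace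
`N` that is orthogonal to `K` (`coreOrthogonal`); it consists of the `y` with `Bⁿ y ⊥ K` for all `n ≥ 0`.

*Self-adjoint parts.* Since the range of `A` is `Kᗮ` and `B A x = x`, `B` maps `N` into `Dom A`,
and the part of `A` in `N` is the inverse of the bounded injective self-adjoint operator `B|_N`
(`hasSelfAdjointPart_coreOrthogonal`). Conversely, a self-adjoint part of `A` is positive
definite, hence onto, so its subspace lies in the range `Kᗮ` of `A` and is invariant under `B`
(`HasSelfAdjointPart.le_coreOrthogonal`).

*Reachable states.* With `S(t) = L^{-1/2} sin (t L^{1/2})`, the orthogonal complement of the reachable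
set is `N` (`orthogonal_totalReachableSet`). If `y ∈ N`, then `S(t) y ∈ N` is orthogonal to `K`, so `y` is
orthogonal to every weak solution. If `y` is orthogonal to the reachable states, the controls
`s² k / 2` with `k ∈ K` give, after differentiation in time, `⟪y, S(t) k⟫ = t ⟪y, k⟫`. As `S` is bounded,
both sides vanish. The same argument passes from `y` to `B y`, because the identity
`B S(t) = t B - ∫_0^t ∫_0^s S(r) dr ds` makes `⟪k, S(t) B y⟫ = t ⟪k, B y⟫` when all `⟪k, S(t) y⟫` vanish
(`inner_friedrichsInv_eq_zero`). By induction `Bⁿ y ⊥ K` for all `n`.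
-/

open Filter Topology Set
open scoped InnerProductSpace

/-! ### Trigonometric functions of the square root of a positive operator -/

theorem abs_cos_add_sub_cos_add_mul_sin_le (a δ : ℝ) :
    |Real.cos (a + δ) - Real.cos a + δ * Real.sin a| ≤ δ ^ 2 := by
  have h := Convex.norm_image_sub_le_of_norm_hasDerivWithin_le
    (f := fun x => Real.cos x + x * Real.sin a) (f' := fun x => -Real.sin x + Real.sin a)
    (s := uIcc a (a + δ)) (x := a) (y := a + δ) (C := |δ|)
    (fun x _ => ((Real.hasDerivAt_cos x).add
      ((hasDerivAt_id x).mul_const (Real.sin a))).hasDerivWithinAt.congr_deriv (by simp))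
    (fun x hx => by
      have h1 : |x - a| ≤ |δ| := by
        simpa using abs_sub_left_of_mem_uIcc hx
      have h2 : |Real.sin a - Real.sin x| ≤ |a - x| := by
        simpa [Real.dist_eq] using Real.lipschitzWith_sin.dist_le_mul a x
      rw [Real.norm_eq_abs, neg_add_eq_sub]
      exact h2.trans (abs_sub_comm a x ▸ h1))
    (convex_uIcc _ _) left_mem_uIcc right_mem_uIcc
  simp only [Real.norm_eq_abs, add_sub_cancel_left] at h
  rw [← sq_abs, sq |δ|]
  convert h using 2
  ring

theorem abs_sin_add_sub_sin_sub_mul_cos_le (a δ : ℝ) :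
    |Real.sin (a + δ) - Real.sin a - δ * Real.cos a| ≤ δ ^ 2 := by
  have h := abs_cos_add_sub_cos_add_mul_sin_le (a - Real.pi / 2) δ
  rw [← add_sub_right_comm a δ, Real.cos_sub_pi_div_two, Real.cos_sub_pi_div_two,
    Real.sin_sub_pi_div_two] at h
  simpa only [mul_neg, ← sub_eq_add_neg] using h

/-- `μ ↦ √μ sin (t / √μ)` is continuous, also at the points where `√μ = 0`. -/
theorem continuous_sqrt_mul_sin (t : ℝ) :
    Continuous fun μ : ℝ => √μ * Real.sin (t * (√μ)⁻¹) := by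
  refine continuous_iff_continuousAt.2 fun μ => ?_
  rcases eq_or_ne (√μ) 0 with h0 | h0
  · rw [ContinuousAt, h0, zero_mul]
    refine squeeze_zero_norm (a := fun μ => √μ) (fun x => ?_)
      (h0 ▸ Real.continuous_sqrt.tendsto μ)
    rw [norm_mul, Real.norm_of_nonneg (Real.sqrt_nonneg _)]
    exact mul_le_of_le_one_right (Real.sqrt_nonneg _) (Real.abs_sin_le_one _)
  · fun_prop (disch := assumption)

/-- `μ ↦ μ (1 - cos (t / √μ))` (for `μ ≥ 0`) is continuous, also where `√μ = 0`. -/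
theorem continuous_sq_sqrt_mul_one_sub_cos (t : ℝ) :
    Continuous fun μ : ℝ => √μ ^ 2 * (1 - Real.cos (t * (√μ)⁻¹)) := by
  refine continuous_iff_continuousAt.2 fun μ => ?_
  rcases eq_or_ne (√μ) 0 with h0 | h0
  · rw [ContinuousAt, h0]
    refine squeeze_zero_norm' (a := fun μ => √μ ^ 2 * 2) (.of_forall fun x => ?_) ?_ |>.trans_eq ?_
    · rw [norm_mul, Real.norm_of_nonneg (by positivity)]
      gcongr
      rw [Real.norm_eq_abs, abs_le]
      constructor <;> linarith [Real.neg_one_le_cos (x := t * (√x)⁻¹),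
        Real.cos_le_one (t * (√x)⁻¹)]
    · have : ContinuousAt (fun μ : ℝ => √μ ^ 2 * 2) μ := by fun_prop
      simpa [ContinuousAt, h0] using this
    · simp
  · fun_prop (disch := assumption)

section

variable {A : Type*} [NormedRing A] [StarRing A] [NormedAlgebra ℝ A]
 
  [IsometricContinuousFunctionalCalculus ℝ A IsSelfAdjoint]

/-- If `F t` is differentiable in `t` with derivative `G`, with a quadratic remainder that is uniform
on the spectrum of `a`, then `F t a` is differentiable in norm with derivative `G a`. -/
theorem hasDerivAt_cfc {a : A} {F : ℝ → ℝ → ℝ} {G : ℝ → ℝ} {t C : ℝ}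
    (ha : IsSelfAdjoint a) (hF : ∀ s, Continuous (F s)) (hG : Continuous G) (hC : 0 ≤ C)
    (h : ∀ δ, ∀ μ ∈ spectrum ℝ a, |F (t + δ) μ - F t μ - δ * G μ| ≤ C * δ ^ 2) :
    HasDerivAt (fun s => cfc (F s) a) (cfc G a) t := by
  rw [hasDerivAt_iff_isLittleO_nhds_zero]
  have hb : (fun δ : ℝ => cfc (F (t + δ)) a - cfc (F t) a - δ • cfc G a) =O[𝓝 0]
      fun δ : ℝ => δ ^ 2 := by
    refine .of_bound C (.of_forall fun δ => ?_)
    rw [← cfc_smul δ G a hG.continuousOn, ← cfc_sub (F (t + δ)) (F t) a (hF _).continuousOn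
      (hF _).continuousOn, ← cfc_sub (fun μ => F (t + δ) μ - F t μ) (fun μ => δ • G μ) a
      ((hF _).sub (hF _)).continuousOn (hG.const_smul δ).continuousOn,
      Real.norm_of_nonneg (sq_nonneg δ)]
    exact norm_cfc_le (by positivity) fun μ hμ => h δ μ hμ
  exact hb.trans_isLittleO (Asymptotics.isLittleO_pow_id one_lt_two)

/-- `(d/dt) a (1 - cos (t a^{-1/2})) = a^{1/2} sin (t a^{-1/2})` for `a ≥ 0`. Without positivity,
`a` is to be read as its positive part, since `√μ = 0` for `μ < 0`. -/
theorem hasDerivAt_cfc_one_sub_cos {a : A} (ha : IsSelfAdjoint a) (t : ℝ) :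
    HasDerivAt (fun s => cfc (fun μ : ℝ => √μ ^ 2 * (1 - Real.cos (s * (√μ)⁻¹))) a)
      (cfc (fun μ : ℝ => √μ * Real.sin (t * (√μ)⁻¹)) a) t := by
  refine hasDerivAt_cfc (C := 1) ha continuous_sq_sqrt_mul_one_sub_cos
    (continuous_sqrt_mul_sin t) zero_le_one fun δ μ _ => ?_
  rcases eq_or_ne (√μ) 0 with h0 | h0
  · simp only [h0]
    simp
    positivity
  · have e : √μ ^ 2 * (1 - Real.cos ((t + δ) * (√μ)⁻¹)) - √μ ^ 2 * (1 - Real.cos (t * (√μ)⁻¹))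
        - δ * (√μ * Real.sin (t * (√μ)⁻¹)) = -(√μ ^ 2 * (Real.cos (t * (√μ)⁻¹ + δ * (√μ)⁻¹)
          - Real.cos (t * (√μ)⁻¹) + δ * (√μ)⁻¹ * Real.sin (t * (√μ)⁻¹))) := by
      rw [add_mul]
      field_simp
      ring
    rw [e, abs_neg, abs_mul, abs_of_nonneg (sq_nonneg √μ)]
    refine (mul_le_mul_of_nonneg_left (abs_cos_add_sub_cos_add_mul_sin_le _ _)
      (sq_nonneg √μ)).trans_eq ?_
    field_simp

/-- `(d/dt) (t a - a^{3/2} sin (t a^{-1/2})) = a (1 - cos (t a^{-1/2}))` for `a ≥ 0`. Without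
positivity, `a` is to be read as its positive part, since `√μ = 0` for `μ < 0`. -/
theorem hasDerivAt_cfc_mul_sub_sin [CompleteSpace A] {a : A} (ha : IsSelfAdjoint a) (t : ℝ) :
    HasDerivAt (fun s => cfc (fun μ : ℝ => √μ ^ 2 * (s - √μ * Real.sin (s * (√μ)⁻¹))) a)
      (cfc (fun μ : ℝ => √μ ^ 2 * (1 - Real.cos (t * (√μ)⁻¹))) a) t := by
  have hcont : ∀ s : ℝ, Continuous fun μ : ℝ => √μ ^ 2 * (s - √μ * Real.sin (s * (√μ)⁻¹)) :=
    fun s => by have := continuous_sqrt_mul_sin s; fun_prop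
  refine hasDerivAt_cfc (C := √(‖a‖ * ‖(1 : A)‖)) ha hcont
    (continuous_sq_sqrt_mul_one_sub_cos t) (Real.sqrt_nonneg _) fun δ μ hμ => ?_
  rcases eq_or_ne (√μ) 0 with h0 | h0
  · simp only [h0]
    simp
    positivity
  · have e : √μ ^ 2 * (t + δ - √μ * Real.sin ((t + δ) * (√μ)⁻¹))
        - √μ ^ 2 * (t - √μ * Real.sin (t * (√μ)⁻¹))
        - δ * (√μ ^ 2 * (1 - Real.cos (t * (√μ)⁻¹))) = -(√μ ^ 3 * (Real.sin (t * (√μ)⁻¹ + δ * (√μ)⁻¹)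
          - Real.sin (t * (√μ)⁻¹) - δ * (√μ)⁻¹ * Real.cos (t * (√μ)⁻¹))) := by
      rw [add_mul]
      field_simp
      ring
    rw [e, abs_neg, abs_mul, abs_of_nonneg (by positivity : 0 ≤ √μ ^ 3)]
    calc √μ ^ 3 * _ ≤ √μ ^ 3 * (δ * (√μ)⁻¹) ^ 2 :=
          mul_le_mul_of_nonneg_left (abs_sin_add_sub_sin_sub_mul_cos_le _ _) (by positivity)
      _ = √μ * δ ^ 2 := by field_simp
      _ ≤ √(‖a‖ * ‖(1 : A)‖) * δ ^ 2 := by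
        gcongr
        exact (le_abs_self μ).trans (spectrum.norm_le_norm_mul_of_mem hμ)

end

section FriedrichsExtension

variable {H : Type*} [NormedAddCommGroup H] [InnerProductSpace ℂ H]

/-! ### Ranges of closed operators -/

theorem LinearPMap.IsClosed.isClosed_range [CompleteSpace H] {T : H →ₗ.[ℂ] H} (hT : T.IsClosed) {κ : ℝ}
    (hκ : 0 < κ) (h : ∀ x : T.domain, κ * ‖(x : H)‖ ≤ ‖T x‖) :
    _root_.IsClosed (LinearMap.range T.toFun : Set H) := by
  refine isClosed_of_closure_subset fun y hy => ?_
  obtain ⟨s, hs, hlim⟩ := mem_closure_iff_seq_limit.1 hy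
  choose u hu using hs
  have hu' : ∀ n, T (u n) = s n := hu
  have hc : CauchySeq fun n => (u n : H) := by
    rw [Metric.cauchySeq_iff]
    intro ε hε
    obtain ⟨N, hN⟩ := Metric.cauchySeq_iff.1 hlim.cauchySeq (κ * ε) (by positivity)
    refine ⟨N, fun m hm n hn => ?_⟩
    have h1 := hN m hm n hn
    have h2 := h (u m - u n)
    rw [dist_eq_norm, ← hu', ← hu', ← LinearPMap.map_sub] at h1
    rw [dist_eq_norm]
    exact lt_of_mul_lt_mul_left (h2.trans_lt h1) hκ.le
  obtain ⟨x, hx⟩ := cauchySeq_tendsto_of_complete hc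
  have hg : (x, y) ∈ (T.graph : Set (H × H)) := by
    refine hT.mem_of_tendsto (hx.prodMk_nhds hlim) (.of_forall fun n => ?_)
    rw [← hu']
    exact T.mem_graph (u n)
  obtain ⟨x', -, hx'⟩ := T.mem_graph_iff.1 hg
  exact ⟨x', hx'⟩

namespace IsPosDefSymmetric

variable {A : H →ₗ.[ℂ] H}

theorem exists_bound_below (hA : IsPosDefSymmetric A) :
    ∃ κ : ℝ, 0 < κ ∧ ∀ x : A.domain, κ * ‖(x : H)‖ ≤ ‖A x‖ := by
  obtain ⟨κ, hκ, h⟩ := hA.pos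
  refine ⟨κ, hκ, fun x => ?_⟩
  rcases (norm_nonneg (x : H)).eq_or_lt with h0 | h0
  · rw [← h0, mul_zero]
    exact norm_nonneg _
  · refine le_of_mul_le_mul_right ?_ h0
    calc κ * ‖(x : H)‖ * ‖(x : H)‖ = κ * ‖(x : H)‖ ^ 2 := by ring
      _ ≤ _ := h x
      _ ≤ _ := (Complex.re_le_norm _).trans (norm_inner_le_norm _ _)

variable [CompleteSpace H]

theorem mem_adjointKer_iff (hA : IsPosDefSymmetric A) {k : H} :
    k ∈ adjointKer A ↔ ∀ x : A.domain, ⟪k, A x⟫_ℂ = 0 := by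
  constructor
  · rintro ⟨y, hy, rfl⟩ x
    have := LinearPMap.adjoint_isFormalAdjoint hA.dense y x
    have hy' : A.adjoint y = 0 := hy
    rw [hy', inner_zero_left] at this
    exact this.symm
  · intro h
    have h1 : ∀ x : A.domain, ⟪(0 : H), (x : H)⟫_ℂ = ⟪k, A x⟫_ℂ := fun x => by
      rw [h, inner_zero_left]
    exact ⟨⟨k, LinearPMap.mem_adjoint_domain_of_exists k ⟨0, h1⟩⟩,
      LinearPMap.adjoint_apply_eq hA.dense _ h1, rfl⟩

theorem adjointKer_eq_orthogonal_range (hA : IsPosDefSymmetric A) :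
    adjointKer A = (LinearMap.range A.toFun)ᗮ := by
  ext k
  rw [hA.mem_adjointKer_iff, Submodule.mem_orthogonal']
  exact ⟨by rintro h _ ⟨x, rfl⟩; exact h x, fun h x => h _ ⟨x, rfl⟩⟩

theorem orthogonal_adjointKer (hA : IsPosDefSymmetric A) :
    (adjointKer A)ᗮ = LinearMap.range A.toFun := by
  obtain ⟨κ, hκ, h⟩ := hA.exists_bound_below
  rw [hA.adjointKer_eq_orthogonal_range, Submodule.orthogonal_orthogonal_eq_closure]
  exact (hA.isClosed.isClosed_range hκ h).submodule_topologicalClosure_eq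

end IsPosDefSymmetric

/-! ### The inverse of the Friedrichs extension -/

section Inverse

variable [CompleteSpace H] {A : H →ₗ.[ℂ] H} (hA : IsPosDefSymmetric A)

theorem friedrichs_friedrichsInv (f : H) :
    ∃ hf : friedrichsInv A hA f ∈ (friedrichs A hA).domain,
      friedrichs A hA ⟨friedrichsInv A hA f, hf⟩ = f :=
  (exists_friedrichs_inverse A hA).choose_spec.1 f

theorem friedrichsInv_friedrichs (x : (friedrichs A hA).domain) :
    friedrichsInv A hA (friedrichs A hA x) = x :=
  (exists_friedrichs_inverse A hA).choose_spec.2 x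

theorem friedrichsInv_apply_self (x : A.domain) : friedrichsInv A hA (A x) = x := by
  have hle := LinearPMap.IsFormalAdjoint.le_adjoint hA.dense hA.symm
  have hform : (x : H) ∈ formDomain A hA :=
    ⟨fun _ => (EnergySpace.toDom A hA).symm x, cauchySeq_const _, tendsto_const_nhds⟩
  have h1 : friedrichs A hA ⟨x, hform, hle.1 x.2⟩ = A x :=
    (LinearPMap.domRestrict_apply (f := A.adjoint) (y := ⟨x, hle.1 x.2⟩) rfl).trans
      (hle.2 (x := x) (y := ⟨x, hle.1 x.2⟩) rfl).symm
  rw [← h1, friedrichsInv_friedrichs]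

theorem friedrichsInv_injective : Function.Injective (friedrichsInv A hA) := by
  refine (injective_iff_map_eq_zero _).2 fun f hf => ?_
  obtain ⟨h1, h2⟩ := friedrichs_friedrichsInv hA f
  rw [← h2, ← LinearPMap.map_zero (friedrichs A hA)]
  congr 1
  exact Subtype.ext hf

/-- With `j` the canonical map of the energy completion to `H`, the inverse of the Friedrichs
extension is `j j^*`. -/
theorem friedrichsInv_isPositive : (friedrichsInv A hA).IsPositive := by
  obtain ⟨j, hj, hjA⟩ := exists_energyCompletion_map A hA
  suffices h : friedrichsInv A hA = j ∘L j.adjoint from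
    h ▸ ContinuousLinearMap.isPositive_self_comp_adjoint j
  ext f
  obtain ⟨⟨⟨u, hu, hux⟩, hadj⟩, hf⟩ := friedrichs_friedrichsInv hA f
  rw [show friedrichs A hA ⟨friedrichsInv A hA f, ⟨⟨u, hu, hux⟩, hadj⟩⟩ =
    A.adjoint ⟨_, hadj⟩ from LinearPMap.domRestrict_apply rfl] at hf
  have hu' : CauchySeq fun n => ((u n : EnergySpace A hA) :
      UniformSpace.Completion (EnergySpace A hA)) :=
    (UniformSpace.Completion.isUniformInducing_coe _).cauchy_map_iff.2 hu
  obtain ⟨w, hw⟩ := cauchySeq_tendsto_of_complete hu'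
  have hjw : j w = friedrichsInv A hA f := by
    refine tendsto_nhds_unique ?_ hux
    simpa only [Function.comp_def, hj] using (j.continuous.tendsto w).comp hw
  have hwf : w = j.adjoint f := by
    refine UniformSpace.Completion.denseRange_coe.eq_of_inner_left ℂ fun y => ?_
    rw [ContinuousLinearMap.adjoint_inner_left, hj, ← hjA, hjw,
      ← LinearPMap.adjoint_isFormalAdjoint hA.dense ⟨_, hadj⟩ (EnergySpace.toDom A hA y), hf]
    rfl
  rw [← hjw, hwf]
  rfl

theorem friedrichsInv_isSelfAdjoint : IsSelfAdjoint (friedrichsInv A hA) :=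
  (friedrichsInv_isPositive hA).isSelfAdjoint

theorem inner_friedrichsInv (x y : H) :
    ⟪friedrichsInv A hA x, y⟫_ℂ = ⟪x, friedrichsInv A hA y⟫_ℂ :=
  (friedrichsInv_isPositive hA).inner_left_eq_inner_right x y

theorem nonneg_of_mem_spectrum_friedrichsInv {μ : ℝ} (hμ : μ ∈ spectrum ℝ (friedrichsInv A hA)) :
    0 ≤ μ :=
  spectrum_nonneg_of_nonneg
    ((ContinuousLinearMap.nonneg_iff_isPositive _).2 (friedrichsInv_isPositive hA)) hμ

/-- A vector orthogonal to `Ker A^*` is mapped by `L⁻¹` into `Dom A`, and not only into `Dom L`. -/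
theorem friedrichsInv_mem_domain {y : H} (hy : y ∈ (adjointKer A)ᗮ) :
    ∃ h : friedrichsInv A hA y ∈ A.domain, A ⟨friedrichsInv A hA y, h⟩ = y := by
  rw [hA.orthogonal_adjointKer] at hy
  obtain ⟨x, rfl⟩ := hy
  have hx : friedrichsInv A hA (A x) = x := friedrichsInv_apply_self hA x
  exact ⟨hx ▸ x.2, congrArg A (Subtype.ext hx)⟩

end Inverse

/-! ### The operators `L^{-1/2} sin (t L^{1/2})` -/

section Sine

variable [CompleteSpace H] {A : H →ₗ.[ℂ] H} (hA : IsPosDefSymmetric A)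

theorem norm_sineOp_le (t : ℝ) : ‖sineOp A hA t‖ ≤ √‖friedrichsInv A hA‖ := by
  refine norm_cfc_le (Real.sqrt_nonneg _) fun μ hμ => ?_
  rw [norm_mul, Real.norm_of_nonneg (Real.sqrt_nonneg _)]
  refine (mul_le_of_le_one_right (Real.sqrt_nonneg _) (Real.abs_sin_le_one _)).trans
    (Real.sqrt_le_sqrt ?_)
  refine (le_abs_self μ).trans ((spectrum.norm_le_norm_mul_of_mem hμ).trans ?_)
  exact mul_le_of_le_one_right (norm_nonneg _) ContinuousLinearMap.norm_id_le

theorem lipschitzWith_sineOp : LipschitzWith 1 (sineOp A hA) := by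
  refine .of_dist_le_mul fun s t => ?_
  have h1 : sineOp A hA s - sineOp A hA t = cfc (fun μ : ℝ =>
      √μ * Real.sin (s * (√μ)⁻¹) - √μ * Real.sin (t * (√μ)⁻¹)) (friedrichsInv A hA) :=
    (cfc_sub _ _ _ (continuous_sqrt_mul_sin s).continuousOn
      (continuous_sqrt_mul_sin t).continuousOn).symm
  rw [dist_eq_norm, h1, NNReal.coe_one, one_mul]
  refine norm_cfc_le dist_nonneg fun μ _ => ?_
  have h2 := Real.lipschitzWith_sin.dist_le_mul (s * (√μ)⁻¹) (t * (√μ)⁻¹)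
  rw [NNReal.coe_one, one_mul, Real.dist_eq, Real.dist_eq, ← sub_mul, abs_mul,
    abs_of_nonneg (inv_nonneg.2 (Real.sqrt_nonneg μ))] at h2
  rw [← mul_sub, norm_mul, Real.norm_of_nonneg (Real.sqrt_nonneg _), Real.norm_eq_abs]
  refine (mul_le_mul_of_nonneg_left h2 (Real.sqrt_nonneg _)).trans ?_
  rw [mul_left_comm, Real.dist_eq]
  exact mul_le_of_le_one_right (abs_nonneg _) (mul_inv_le_one)

theorem inner_sineOp (t : ℝ) (x y : H) : ⟪sineOp A hA t x, y⟫_ℂ = ⟪x, sineOp A hA t y⟫_ℂ :=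
  (cfc_predicate _ _ : IsSelfAdjoint (sineOp A hA t)).isSymmetric x y

theorem sineOp_zero : sineOp A hA 0 = 0 := by
  simp [sineOp]

/-- The operators `L^{-1/2} sin (t L^{1/2})` leave the closed subspaces invariant that are
invariant under `L⁻¹`, because they commute with the orthogonal projection. -/
theorem sineOp_mem {N : Submodule ℂ H} [CompleteSpace N]
    (hN : ∀ y ∈ N, friedrichsInv A hA y ∈ N) (t : ℝ) {y : H} (hy : y ∈ N) :
    sineOp A hA t y ∈ N := by
  have hN' : ∀ z ∈ Nᗮ, friedrichsInv A hA z ∈ Nᗮ := fun z hz => by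
    rw [Submodule.mem_orthogonal] at hz ⊢
    intro u hu
    rw [← inner_friedrichsInv]
    exact hz _ (hN u hu)
  have hcomm : Commute (friedrichsInv A hA) N.starProjection := by
    ext x
    refine (Submodule.eq_starProjection_of_mem_orthogonal (hN _ (N.starProjection_apply_mem x))
      ?_).symm
    change friedrichsInv A hA x - friedrichsInv A hA (N.starProjection x) ∈ Nᗮ
    rw [← map_sub]
    exact hN' _ (N.sub_starProjection_mem_orthogonal x)
  have h := DFunLike.congr_fun (hcomm.cfc_real
    (fun μ : ℝ => √μ * Real.sin (t * (√μ)⁻¹))).eq y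
  change sineOp A hA t (N.starProjection y) = N.starProjection (sineOp A hA t y) at h
  rw [Submodule.starProjection_eq_self_iff.2 hy] at h
  exact Submodule.starProjection_eq_self_iff.1 h.symm

/-- A linear function of `t` that is bounded on the half-line is zero. -/
theorem eq_zero_of_norm_mul_le {c : ℂ} {C : ℝ} (h : ∀ t : ℝ, 0 ≤ t → ‖(t : ℂ) * c‖ ≤ C) : c = 0 := by
  by_contra hc
  have hc' : 0 < ‖c‖ := norm_pos_iff.2 hc
  have hC : 0 ≤ C := by simpa using h 0 le_rfl
  have := h ((C + 1) / ‖c‖) (by positivity)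
  rw [norm_mul, Complex.norm_real, Real.norm_of_nonneg (by positivity),
    div_mul_cancel₀ _ hc'.ne'] at this
  linarith

/-- With `S(t) = L^{-1/2} sin (t L^{1/2})`, if `⟪x, S(t) y⟫` is linear in `t ≥ 0` then it
vanishes, since `S` is bounded. -/
theorem inner_sineOp_eq_zero_of_linear {x y : H} {c : ℂ}
    (h : ∀ t : ℝ, 0 ≤ t → ⟪x, sineOp A hA t y⟫_ℂ = t * c) :
    c = 0 ∧ ∀ t : ℝ, 0 ≤ t → ⟪x, sineOp A hA t y⟫_ℂ = 0 := by
  have hc : c = 0 := by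
    refine eq_zero_of_norm_mul_le (C := ‖x‖ * (√‖friedrichsInv A hA‖ * ‖y‖)) fun t ht => ?_
    rw [← h t ht]
    refine (norm_inner_le_norm _ _).trans ?_
    gcongr
    exact (sineOp A hA t).le_of_opNorm_le (norm_sineOp_le hA t) y
  exact ⟨hc, fun t ht => by rw [h t ht, hc, mul_zero]⟩

theorem sineOp_neg (t : ℝ) : sineOp A hA (-t) = -sineOp A hA t := by
  rw [sineOp, sineOp, ← cfc_neg]
  simp

/-- With `S(t) = L^{-1/2} sin (t L^{1/2})`, the identity
`L⁻¹ S(t) = t L⁻¹ - ∫_0^t ∫_0^s S(r) dr ds` shows that the functions `⟪x, L⁻¹ S(t) y⟫` are linear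
if the functions `⟪x, S(t) y⟫` vanish. -/
theorem inner_friedrichsInv_eq_zero {x y : H}
    (h : ∀ t : ℝ, 0 ≤ t → ⟪x, sineOp A hA t y⟫_ℂ = 0) :
    ⟪x, friedrichsInv A hA y⟫_ℂ = 0 ∧
      ∀ t : ℝ, 0 ≤ t → ⟪x, sineOp A hA t (friedrichsInv A hA y)⟫_ℂ = 0 := by
  have hS : ∀ t : ℝ, ⟪x, sineOp A hA t y⟫_ℂ = 0 := fun t => by
    rcases le_total 0 t with ht | ht
    · exact h t ht
    · have := h (-t) (by linarith)
      rwa [sineOp_neg, neg_apply, inner_neg_right, neg_eq_zero] at this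
  have hB := friedrichsInv_isSelfAdjoint hA
  -- The first and the second antiderivative of `S`, both zero at `t = 0`.
  set P : ℝ → H →L[ℂ] H := fun t =>
    cfc (fun μ : ℝ => √μ ^ 2 * (1 - Real.cos (t * (√μ)⁻¹))) (friedrichsInv A hA)
  set Q : ℝ → H →L[ℂ] H := fun t =>
    cfc (fun μ : ℝ => √μ ^ 2 * (t - √μ * Real.sin (t * (√μ)⁻¹))) (friedrichsInv A hA)
  let ℓ : (H →L[ℂ] H) →L[ℝ] ℂ :=
    (((innerSL ℂ x).comp (ContinuousLinearMap.apply ℂ H y)).restrictScalars ℝ)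
  have hP : ∀ t, ℓ (P t) = 0 := fun t => by
    have hd : ∀ s, HasDerivAt (fun s => ℓ (P s)) 0 s := fun s =>
      (ℓ.hasFDerivAt.comp_hasDerivAt s (hasDerivAt_cfc_one_sub_cos hB s)).congr_deriv (hS s)
    rw [is_const_of_deriv_eq_zero (fun s => (hd s).differentiableAt) (fun s => (hd s).deriv) t 0]
    simp [P]
  have hQ : ∀ t, ℓ (Q t) = 0 := fun t => by
    have hd : ∀ s, HasDerivAt (fun s => ℓ (Q s)) 0 s := fun s =>
      (ℓ.hasFDerivAt.comp_hasDerivAt s (hasDerivAt_cfc_mul_sub_sin hB s)).congr_deriv (hP s)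
    rw [is_const_of_deriv_eq_zero (fun s => (hd s).differentiableAt) (fun s => (hd s).deriv) t 0]
    simp [Q]
  have hQeq : ∀ t : ℝ, Q t =
      t • friedrichsInv A hA - sineOp A hA t * friedrichsInv A hA := fun t => by
    have hc := continuous_sqrt_mul_sin t
    calc Q t = cfc (fun μ : ℝ => t • μ - √μ * Real.sin (t * (√μ)⁻¹) * μ) (friedrichsInv A hA) :=
          cfc_congr fun μ hμ => by
            have := Real.sq_sqrt (nonneg_of_mem_spectrum_friedrichsInv hA hμ)
            simp only [this, smul_eq_mul]
            ring
      _ = _ := by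
        rw [cfc_sub _ _ _ (by fun_prop) (by fun_prop), cfc_smul t _ _ (by fun_prop),
          cfc_mul _ _ _ hc.continuousOn (by fun_prop), cfc_id' ℝ (friedrichsInv A hA)]
        rfl
  refine inner_sineOp_eq_zero_of_linear hA fun t _ => ?_
  have := hQ t
  rw [hQeq] at this
  have h2 : ⟪x, t • friedrichsInv A hA y - sineOp A hA t (friedrichsInv A hA y)⟫_ℂ = 0 := this
  rw [inner_sub_right, ← Complex.coe_smul, inner_smul_right, sub_eq_zero] at h2
  exact h2.symm

end Sine

/-! ### The invariant subspace of unreachable states -/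

section Unreachable

variable [CompleteSpace H] {A : H →ₗ.[ℂ] H} (hA : IsPosDefSymmetric A)

/-- The largest subspace that is invariant under the inverse `L⁻¹` of the Friedrichs extension
and orthogonal to `Ker A^*`, encoded as the orthogonal complement of the sum of the subspaces
`L⁻ⁿ Ker A^*`, `n ≥ 0`. -/
noncomputable def coreOrthogonal (A : H →ₗ.[ℂ] H) (hA : IsPosDefSymmetric A) : Submodule ℂ H :=
  (⨆ n : ℕ, (adjointKer A).map
    ((friedrichsInv A hA ^ n : H →L[ℂ] H) : H →ₗ[ℂ] H))ᗮ

theorem mem_coreOrthogonal_iff {y : H} :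
    y ∈ coreOrthogonal A hA ↔
      ∀ (n : ℕ), ∀ k ∈ adjointKer A, ⟪k, (friedrichsInv A hA ^ n) y⟫_ℂ = 0 := by
  have hsymm : ∀ (n : ℕ) (k : H), ⟪(friedrichsInv A hA ^ n) k, y⟫_ℂ =
      ⟪k, (friedrichsInv A hA ^ n) y⟫_ℂ :=
    fun n k => ((friedrichsInv_isSelfAdjoint hA).pow n).isSymmetric k y
  rw [coreOrthogonal, ← Submodule.iInf_orthogonal, Submodule.mem_iInf]
  refine forall_congr' fun n => ⟨fun h k hk => ?_, ?_⟩
  · rw [← hsymm]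
    exact Submodule.mem_orthogonal _ _ |>.1 h _ ⟨k, hk, rfl⟩
  · rintro h _ ⟨k, hk, rfl⟩
    exact (hsymm n k).trans (h k hk)

theorem coreOrthogonal_le_orthogonal_adjointKer :
    coreOrthogonal A hA ≤ (adjointKer A)ᗮ := fun _ hy k hk =>
  (mem_coreOrthogonal_iff hA).1 hy 0 k hk

theorem friedrichsInv_mem_coreOrthogonal {y : H} (hy : y ∈ coreOrthogonal A hA) :
    friedrichsInv A hA y ∈ coreOrthogonal A hA := by
  rw [mem_coreOrthogonal_iff] at hy ⊢
  intro n k hk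
  have := hy (n + 1) k hk
  rwa [pow_succ] at this

theorem le_coreOrthogonal {N : Submodule ℂ H} (hK : N ≤ (adjointKer A)ᗮ)
    (hN : ∀ y ∈ N, friedrichsInv A hA y ∈ N) : N ≤ coreOrthogonal A hA := by
  intro y hy
  rw [mem_coreOrthogonal_iff]
  intro n k hk
  have hmem : (friedrichsInv A hA ^ n) y ∈ N := by
    induction n with
    | zero => exact hy
    | succ n ih =>
      rw [pow_succ']
      exact hN _ ih
  exact hK hmem k hk

/-! ### Self-adjoint parts -/

theorem apply_mem_coreOrthogonal (x : A.domain) (hx : (x : H) ∈ coreOrthogonal A hA) :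
    A x ∈ coreOrthogonal A hA := by
  rw [mem_coreOrthogonal_iff] at hx ⊢
  rintro (_ | n) k hk
  · exact (hA.mem_adjointKer_iff.1 hk) x
  · have h := hx n k hk
    rw [pow_succ]
    change ⟪k, (friedrichsInv A hA ^ n) (friedrichsInv A hA (A x))⟫_ℂ = 0
    rwa [friedrichsInv_apply_self]

instance : CompleteSpace (coreOrthogonal A hA) :=
  inferInstanceAs (CompleteSpace (⨆ n : ℕ, (adjointKer A).map
    ((friedrichsInv A hA ^ n : H →L[ℂ] H) : H →ₗ[ℂ] H))ᗮ)

/-- The part of `A` in `coreOrthogonal A hA` is the inverse of the restriction of `L⁻¹`, a bounded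
injective self-adjoint operator. -/
theorem hasSelfAdjointPart_coreOrthogonal : HasSelfAdjointPart A (coreOrthogonal A hA) := by
  set N := coreOrthogonal A hA with hN
  have hinv : ∀ v ∈ N, ∃ h : friedrichsInv A hA v ∈ A.domain,
      A ⟨friedrichsInv A hA v, h⟩ = v := fun v hv =>
    friedrichsInv_mem_domain hA (coreOrthogonal_le_orthogonal_adjointKer hA hv)
  have hBN : ∀ v ∈ N, friedrichsInv A hA v ∈ N := fun v hv =>
    friedrichsInv_mem_coreOrthogonal hA hv
  have hpart : ∀ x : A.domain, (x : H) ∈ N → A x ∈ N := apply_mem_coreOrthogonal hA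
  have hdense : Dense {x : N | (x : H) ∈ A.domain} := by
    change Dense ((A.domain.comap N.subtype : Submodule ℂ N) : Set N)
    rw [Submodule.dense_iff_topologicalClosure_eq_top, Submodule.topologicalClosure_eq_top_iff,
      Submodule.eq_bot_iff]
    intro y hy
    have h0 : friedrichsInv A hA y = 0 := by
      have := hy ⟨_, hBN _ (hBN _ y.2)⟩ (hinv _ (hBN _ y.2)).1
      rw [Submodule.coe_inner] at this
      change ⟪friedrichsInv A hA (friedrichsInv A hA y), (y : H)⟫_ℂ = 0 at this
      rwa [inner_friedrichsInv, inner_self_eq_zero] at this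
    exact Subtype.ext (friedrichsInv_injective hA (h0.trans (map_zero _).symm))
  refine ⟨hdense, hpart, ?_⟩
  rw [LinearPMap.isSelfAdjoint_def]
  have hsymm : (partIn A N hpart).IsFormalAdjoint (partIn A N hpart) := fun x y =>
    hA.symm ⟨(x : N), x.2⟩ ⟨(y : N), y.2⟩
  have hdense' : Dense ((partIn A N hpart).domain : Set N) := hdense
  have hle := LinearPMap.IsFormalAdjoint.le_adjoint hdense' hsymm
  refine (LinearPMap.eq_of_le_of_domain_eq hle (le_antisymm hle.1 fun y hy => ?_)).symm
  -- Testing against `L⁻¹ v` shows `y = L⁻¹ z` for `z` the value of the adjoint at `y`.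
  set z : N := (partIn A N hpart).adjoint ⟨y, hy⟩ with hz
  have hyz : (⟨friedrichsInv A hA z, hBN _ z.2⟩ : N) = y := by
    refine ext_inner_right ℂ fun v => ?_
    obtain ⟨hv, hAv⟩ := hinv v v.2
    have h1 := LinearPMap.adjoint_isFormalAdjoint hdense' ⟨y, hy⟩
      ⟨⟨friedrichsInv A hA v, hBN _ v.2⟩, hv⟩
    rw [← hz] at h1
    have h2 : partIn A N hpart ⟨⟨friedrichsInv A hA v, hBN _ v.2⟩, hv⟩ = v := Subtype.ext hAv
    rw [h2] at h1
    rw [← h1, Submodule.coe_inner, Submodule.coe_inner]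
    exact inner_friedrichsInv hA _ _
  rw [← hyz]
  exact (hinv _ z.2).1

/-- A self-adjoint part of `A` is positive definite, hence onto, and its inverse is the restriction
of `L⁻¹`. -/
theorem HasSelfAdjointPart.le_coreOrthogonal {N : Submodule ℂ H} [CompleteSpace N]
    (h : HasSelfAdjointPart A N) : N ≤ coreOrthogonal A hA := by
  obtain ⟨-, hpart, hsa⟩ := h
  obtain ⟨κ, hκ, hbound⟩ := hA.exists_bound_below
  set T := partIn A N hpart with hT
  have hTbound : ∀ x : T.domain, κ * ‖(x : N)‖ ≤ ‖T x‖ := fun x => hbound ⟨(x : N), x.2⟩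
  have hrange : LinearMap.range T.toFun = ⊤ := by
    rw [← (hsa.isClosed.isClosed_range hκ hTbound).submodule_topologicalClosure_eq,
      Submodule.topologicalClosure_eq_top_iff, Submodule.eq_bot_iff]
    intro y hy
    have h0 : ∀ x : T.domain, ⟪(0 : N), (x : N)⟫_ℂ = ⟪y, T x⟫_ℂ := fun x => by
      rw [inner_zero_left]
      exact ((Submodule.mem_orthogonal' _ _).1 hy _ ⟨x, rfl⟩).symm
    have hy' : y ∈ T.adjoint.domain := LinearPMap.mem_adjoint_domain_of_exists y ⟨0, h0⟩
    have hTy := LinearPMap.adjoint_apply_eq hsa.dense_domain ⟨y, hy'⟩ h0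
    rw [LinearPMap.isSelfAdjoint_def] at hsa
    have hyT : y ∈ T.domain := hsa ▸ hy'
    have hTy' : T ⟨y, hyT⟩ = 0 := by
      rw [← hTy]
      exact hsa.ge.2 rfl
    have := hTbound ⟨y, hyT⟩
    rw [hTy', norm_zero] at this
    exact norm_le_zero_iff.1 (nonpos_of_mul_nonpos_right this hκ)
  have hsurj : ∀ y ∈ N, ∃ x : A.domain, (x : H) ∈ N ∧ A x = y := fun y hy => by
    obtain ⟨x, hx⟩ : (⟨y, hy⟩ : N) ∈ LinearMap.range T.toFun := hrange ▸ Submodule.mem_top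
    exact ⟨⟨(x : N), x.2⟩, (x : N).2, congrArg Subtype.val hx⟩
  refine _root_.le_coreOrthogonal hA (fun y hy => ?_) fun y hy => ?_
  · obtain ⟨x, -, rfl⟩ := hsurj y hy
    exact fun k hk => hA.mem_adjointKer_iff.1 hk x
  · obtain ⟨x, hx, rfl⟩ := hsurj y hy
    rwa [friedrichsInv_apply_self]

theorem isCompletelyNonSelfAdjoint_iff :
    IsCompletelyNonSelfAdjoint A ↔ coreOrthogonal A hA = ⊥ := by
  constructor
  · intro h
    by_contra hne
    exact h _ hne (hasSelfAdjointPart_coreOrthogonal hA)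
  · intro h N _ hne hN
    exact hne (le_bot_iff.1 (h ▸ hN.le_coreOrthogonal hA))

/-! ### The orthogonal complement of the reachable set -/

theorem inner_weakSolution_eq_zero {h : ℝ → adjointKer A} (hh : IsControl A h)
    {t : ℝ} (ht : 0 ≤ t) {y : H} (hy : y ∈ coreOrthogonal A hA) :
    ⟪y, weakSolution A hA h t⟫_ℂ = 0 := by
  have hK : ∀ z ∈ coreOrthogonal A hA, ∀ k : adjointKer A, ⟪z, (k : H)⟫_ℂ = 0 := fun z hz k =>
    (Submodule.mem_orthogonal' _ _).1 (coreOrthogonal_le_orthogonal_adjointKer hA hz) _ k.2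
  have hint : IntervalIntegrable (fun s => sineOp A hA (t - s)
      ((iteratedDerivWithin 2 h (Ici 0) s : adjointKer A) : H)) MeasureTheory.volume 0 t := by
    refine ContinuousOn.intervalIntegrable ?_
    rw [uIcc_of_le ht]
    have h1 : ContinuousOn (iteratedDerivWithin 2 h (Ici 0)) (Icc 0 t) :=
      (hh.1.continuousOn_iteratedDerivWithin le_rfl (uniqueDiffOn_Ici 0)).mono Icc_subset_Ici_self
    exact ((lipschitzWith_sineOp hA).continuous.comp (continuous_const.sub
      continuous_id)).continuousOn.clm_apply (continuous_subtype_val.comp_continuousOn h1)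
  rw [weakSolution, inner_add_right, inner_neg_right, hK y hy, neg_zero, zero_add]
  have := ((innerSL ℂ y).restrictScalars ℝ).intervalIntegral_comp_comm hint
  refine this.symm.trans (intervalIntegral.integral_zero_ae (.of_forall fun s _ => ?_))
  change ⟪y, sineOp A hA (t - s) _⟫_ℂ = 0
  rw [← inner_sineOp]
  exact hK _ (sineOp_mem hA (fun _ => friedrichsInv_mem_coreOrthogonal hA) _ hy) _

/-- The control `h(s) = s² k / 2`, whose second derivative is constant. -/
theorem isControl_sq_smul (k : adjointKer A) :
    IsControl A (fun s : ℝ => (s ^ 2 / 2) • k) ∧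
      ∀ s : ℝ, 0 ≤ s → iteratedDerivWithin 2 (fun s : ℝ => (s ^ 2 / 2) • k) (Ici 0) s = k := by
  have hd : ∀ s : ℝ, HasDerivAt (fun s : ℝ => (s ^ 2 / 2) • k) (s • k) s := fun s =>
    (((hasDerivAt_pow 2 s).div_const 2).smul_const k).congr_deriv (by simp)
  have hd1 : EqOn (derivWithin (fun s : ℝ => (s ^ 2 / 2) • k) (Ici 0)) (fun s => s • k)
      (Ici 0) := fun s hs => (hd s).hasDerivWithinAt.derivWithin (uniqueDiffOn_Ici 0 s hs)
  refine ⟨⟨by fun_prop, by simp, by simpa using hd1 (self_mem_Ici)⟩, fun s hs => ?_⟩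
  rw [iteratedDerivWithin_succ, iteratedDerivWithin_one, derivWithin_congr hd1 (hd1 hs)]
  exact (((hasDerivAt_id s).smul_const k).congr_deriv
    (one_smul ℝ k)).hasDerivWithinAt.derivWithin (uniqueDiffOn_Ici 0 s hs)

theorem weakSolution_sq_smul (k : adjointKer A) {t : ℝ} (ht : 0 ≤ t) :
    weakSolution A hA (fun s : ℝ => (s ^ 2 / 2) • k) t =
      -((t ^ 2 / 2) • (k : H)) + ∫ s in (0 : ℝ)..t, sineOp A hA s k := by
  rw [weakSolution]
  congr 1
  have h1 : ∀ s ∈ uIcc 0 t, sineOp A hA (t - s)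
      ((iteratedDerivWithin 2 (fun s : ℝ => (s ^ 2 / 2) • k) (Ici 0) s : adjointKer A) : H) =
      sineOp A hA (t - s) k := fun s hs => by
    rw [uIcc_of_le ht] at hs
    rw [(isControl_sq_smul k).2 s hs.1]
  rw [intervalIntegral.integral_congr h1,
    intervalIntegral.integral_comp_sub_left (fun s => sineOp A hA s (k : H)) t]
  simp

/-- Differentiating in `t` the orthogonality to the states reached by the controls `s² k / 2`. -/
theorem inner_sineOp_eq_mul {y : H} (hy : y ∈ (totalReachableSet A hA)ᗮ) (k : adjointKer A)
    {t : ℝ} (ht : 0 ≤ t) : ⟪y, sineOp A hA t k⟫_ℂ = t * ⟪y, (k : H)⟫_ℂ := by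
  have hcont : Continuous fun s => sineOp A hA s (k : H) :=
    (lipschitzWith_sineOp hA).continuous.clm_apply continuous_const
  have hint : ∀ s : ℝ, 0 ≤ s →
      ⟪y, -((s ^ 2 / 2) • (k : H)) + ∫ r in (0 : ℝ)..s, sineOp A hA r k⟫_ℂ = 0 := fun s hs => by
    rw [← weakSolution_sq_smul hA k hs]
    exact (Submodule.mem_orthogonal' _ _).1 hy _
      (Submodule.subset_span (mem_biUnion hs ⟨_, (isControl_sq_smul k).1, rfl⟩))
  rcases ht.eq_or_lt with rfl | ht
  · simp [sineOp_zero]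
  have hd : HasDerivAt (fun s : ℝ => -((s ^ 2 / 2) • (k : H)) + ∫ r in (0 : ℝ)..s, sineOp A hA r k)
      (-(t • (k : H)) + sineOp A hA t k) t :=
    ((((hasDerivAt_pow 2 t).div_const 2).smul_const (k : H)).congr_deriv (by simp)).neg.add
      (intervalIntegral.integral_hasDerivAt_right (hcont.intervalIntegrable _ _)
        hcont.stronglyMeasurable.stronglyMeasurableAtFilter hcont.continuousAt)
  have hd' := ((innerSL ℂ y).restrictScalars ℝ).hasFDerivAt.comp_hasDerivAt t hd
  have h0 : HasDerivAt (((innerSL ℂ y).restrictScalars ℝ) ∘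
      fun s : ℝ => -((s ^ 2 / 2) • (k : H)) + ∫ r in (0 : ℝ)..s, sineOp A hA r k) 0 t :=
    (hasDerivAt_const t (0 : ℂ)).congr_of_eventuallyEq
      (by filter_upwards [lt_mem_nhds ht] with s hs using hint s hs.le)
  have h1 : ⟪y, -(t • (k : H)) + sineOp A hA t k⟫_ℂ = 0 := hd'.unique h0
  rw [inner_add_right, inner_neg_right, ← Complex.coe_smul, inner_smul_right,
    neg_add_eq_zero] at h1
  exact h1.symm

theorem orthogonal_totalReachableSet :
    (totalReachableSet A hA)ᗮ = coreOrthogonal A hA := by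
  refine le_antisymm (fun y hy => ?_) fun y hy => ?_
  · rw [mem_coreOrthogonal_iff]
    intro n k hk
    have hn : ⟪k, (friedrichsInv A hA ^ n) y⟫_ℂ = 0 ∧
        ∀ t : ℝ, 0 ≤ t → ⟪k, sineOp A hA t ((friedrichsInv A hA ^ n) y)⟫_ℂ = 0 := by
      induction n with
      | zero =>
        obtain ⟨h1, h2⟩ := inner_sineOp_eq_zero_of_linear hA
          fun t ht => inner_sineOp_eq_mul hA hy ⟨k, hk⟩ ht
        refine ⟨inner_eq_zero_symm.1 h1, fun t ht => ?_⟩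
        rw [← inner_sineOp]
        exact inner_eq_zero_symm.1 (h2 t ht)
      | succ n ih =>
        rw [pow_succ']
        exact inner_friedrichsInv_eq_zero hA ih.2
    exact hn.1
  · rw [totalReachableSet, Submodule.mem_orthogonal]
    intro u hu
    induction hu using Submodule.span_induction with
    | mem u hu =>
      obtain ⟨t, ht, h, hh, rfl⟩ := mem_iUnion₂.1 hu
      exact inner_eq_zero_symm.1 (inner_weakSolution_eq_zero hA hh ht hy)
    | zero => exact inner_zero_left _
    | add u v _ _ hu hv => rw [inner_add_left, hu, hv, add_zero]
    | smul c u _ hu => rw [inner_smul_left, hu, mul_zero]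

end Unreachable

end FriedrichsExtension

theorem theorem1 {H : Type*} [NormedAddCommGroup H] [InnerProductSpace ℂ H] [CompleteSpace H]
    (L₀ : H →ₗ.[ℂ] H) (hL₀ : IsPosDefSymmetric L₀) (hdefect : adjointKer L₀ ≠ ⊥) :
    IsControllable L₀ hL₀ ↔ IsCompletelyNonSelfAdjoint L₀ := by
  rw [IsControllable, Submodule.dense_iff_topologicalClosure_eq_top,
    Submodule.topologicalClosure_eq_top_iff, orthogonal_totalReachableSet,
    isCompletelyNonSelfAdjoint_iff hL₀]
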